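/- Let $K$ be a field and $S=K[x_1,x_2,x_3,x_4]$, with its $\mathbb{Z}^4$-grading in which $x_i$ has degree the $i$-th unit vector. For a nonzero $\mathbb{Z}^4$-graded ideal $I$ of $S$, a \emph{Stanley decomposition} of $I$ is a presentation of the $K$-vector space $I$ as a finite direct sum $\mathcal D:\ I=\bigoplus_{i=1}^r m_iK[Z_i]$, where $m_i\in I$ is homogeneous, $Z_i\subseteq\{x_1,\dots,x_4\}$, $m_iK[Z_i]=\{m_if : f\in K[Z_i]\}$, and $m_iK[Z_i]$ is a free $K[Z_i]$-module with basis $m_i$. Put $\operatorname{sdepth}\mathcal D=\min_i|Z_i|$, and let $\operatorname{sdepth}_S I$ be the maximum of $\operatorname{sdepth}\mathcal D$ over all Stanley decompositions $\mathcal D$ of $I$. Let $\operatorname{depth}_S I$ be the maximal length of an $I$-regular sequence contained in $(x_1,\dots,x_4)$. For $I=0$ both numbers are $\infty$ by convention. Then for every ideal $I$ of $S$ that is generated by squarefree monomials, $$\operatorname{sdepth}_S I\ \ge\ \operatorname{depth}_S I .$$ -/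

import Mathlib

open MvPolynomial

noncomputable section

namespace StanleyConj

/-- The depth of the `R`-module `M` with respect to the ideal `𝔪`: the supremum of the lengths of
the `M`-regular sequences in `𝔪`. If `𝔪 M ≠ M`, then `M / (rs) M ≠ 0` holds for every sequence `rs`
in `𝔪`, so that weak regularity and regularity agree; if `𝔪 M = M` (for instance `M = 0`) and `M` is
finitely generated over a Noetherian ring, the value is `⊤`, which is the usual convention. -/
def depth {R : Type*} [CommRing R] (𝔪 : Ideal R) (M : Type*) [AddCommGroup M] [Module R M] : ℕ∞ :=
  ⨆ (rs : List R) (_ : (∀ r ∈ rs, r ∈ 𝔪) ∧ RingTheory.Sequence.IsWeaklyRegular M rs),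
    (rs.length : ℕ∞)

section Stanley

variable (K : Type*) [Field K] {n : ℕ} {M : Type*} [AddCommGroup M]
  [Module (MvPolynomial (Fin n) K) M] [Module K M] [IsScalarTower K (MvPolynomial (Fin n) K) M]

/-- The `K`-subspace `m K[Z] = {f m : f ∈ K[Z]}` of `M`. -/
def stanleySpace (m : M) (Z : Finset (Fin n)) : Submodule K M :=
  (Subalgebra.toSubmodule (supported K (Z : Set (Fin n)))).map
    ((LinearMap.toSpanSingleton (MvPolynomial (Fin n) K) M m).restrictScalars K)

/-- A Stanley decomposition of the `ℤⁿ`-graded `K[x₁, …, xₙ]`-module `M`, with graded pieces `ℳ a`: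
a presentation of the `K`-vector space `M` as a finite internal direct sum of Stanley spaces
`mᵢ K[Zᵢ]`, where each `mᵢ` is homogeneous and `mᵢ K[Zᵢ]` is free over `K[Zᵢ]` with basis `mᵢ`. -/
structure StanleyDecomposition (ℳ : (Fin n → ℤ) → Submodule K M) where
  r : ℕ
  m : Fin r → M
  Z : Fin r → Finset (Fin n)
  homogeneous : ∀ i, ∃ a, m i ∈ ℳ a
  free : ∀ i, ∀ f ∈ supported K (Z i : Set (Fin n)), f • m i = 0 → f = 0
  internal : DirectSum.IsInternal (fun i => stanleySpace K (m i) (Z i))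

/-- The Stanley depth of a Stanley decomposition: the minimum of the dimensions `|Zᵢ|`
(`⊤` for the empty decomposition of the zero module). -/
def StanleyDecomposition.sdepth {ℳ : (Fin n → ℤ) → Submodule K M}
    (D : StanleyDecomposition K ℳ) : ℕ∞ :=
  ⨅ i, ((D.Z i).card : ℕ∞)

/-- The Stanley depth of the `ℤⁿ`-graded module `M` with graded pieces `ℳ a`: the largest Stanley
depth of a Stanley decomposition of `M`. -/
def stanleyDepth (ℳ : (Fin n → ℤ) → Submodule K M) : ℕ∞ :=
  ⨆ D : StanleyDecomposition K ℳ, D.sdepth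

end Stanley

variable {K : Type*} [Field K] {n : ℕ}

/-- The `ℤⁿ`-graded pieces of an ideal `I` of `K[x₁, …, xₙ]`: in degree `a`, the elements of `I`
that are homogeneous of degree `a`, where `xᵢ` has degree the `i`-th unit vector. -/
def multigrading (I : Ideal (MvPolynomial (Fin n) K)) (a : Fin n → ℤ) : Submodule K I :=
  (weightedHomogeneousSubmodule K (fun i : Fin n => (Pi.single i 1 : Fin n → ℤ)) a).comap
    (I.subtype.restrictScalars K)

/-- `I` is generated by squarefree monomials, that is, by products of distinct variables. -/
def IsSquarefreeMonomialIdeal (I : Ideal (MvPolynomial (Fin n) K)) : Prop :=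
  ∃ 𝓕 : Set (Finset (Fin n)), I = Ideal.span ((fun F => ∏ i ∈ F, X i) '' 𝓕)

end StanleyConj

end

/-! Call the sets `T` with `∏ i ∈ T, X i ∉ I` faces. The depth is bounded above by facets, the
Stanley depth below by intervals of sets, and the two bounds meet.

Depth: for a facet `F`, the class of `x_F · e_F` in the Koszul complex of `S/I` on the squares `x_i
^ 2` is a cocycle. Its image under the connecting map is a nonzero class of degree `|F| + 1` with
coefficients in `I`, while a weakly regular sequence kills the cohomology in positive degrees below
its length (`exists_koszulD_eq`). This gives depth at most `|F| + 1` (`length_le_of_facet`), and a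
top-degree class gives at most the number of variables.

Stanley depth: a partition of the non-faces into intervals `[A, B]` yields a Stanley decomposition
with pieces `x_A K[B]`. For depth `d`, only the non-faces with fewer than `d` elements need to be
placed in intervals with `|B| ≥ d`.

If `I ≠ 0` and some facet has at most one element, 2 suffices. If the smallest facet has two
elements, 3 suffices, and the graph of two-element faces has no isolated vertex. Otherwise all
facets have three elements, `I` is principal and 4 is reached. -/

namespace StanleyConj

/-! ### Koszul cochains and the vanishing theorem -/

section Koszul

variable {R ι : Type*} [CommRing R]

/-- The Koszul differential on cochains indexed by all tuples of indices. -/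
def koszulD {M : Type*} [AddCommGroup M] [Module R M] (y : ι → R) {p : ℕ}
    (u : (Fin p → ι) → M) : (Fin (p + 1) → ι) → M :=
  fun t => ∑ j : Fin (p + 1), ((-1) ^ (j : ℕ) * y (t j)) • u (fun i => t (j.succAbove i))

section

variable {M : Type*} [AddCommGroup M] [Module R M] (y : ι → R) {p : ℕ}

theorem koszulD_zero_left (u : (Fin 0 → ι) → M) (t : Fin 1 → ι) :
    koszulD y u t = y (t 0) • u Fin.elim0 := by
  simp [koszulD, Subsingleton.elim _ (Fin.elim0 : Fin 0 → ι)]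

theorem koszulD_cons (u : (Fin (p + 1) → ι) → M) (i : ι) (t : Fin (p + 1) → ι) :
    koszulD y u (Fin.cons i t) =
      y i • u t - koszulD y (fun s : Fin p → ι => u (Fin.cons i s)) t := by
  have h (j : Fin (p + 1)) : (fun k => (Fin.cons i t : Fin (p + 2) → ι) (j.succ.succAbove k)) =
      Fin.cons i (fun k => t (j.succAbove k)) := by
    funext k
    refine Fin.cases ?_ (fun k => ?_) k
    · simp
    · simp [Fin.succ_succAbove_succ]
  unfold koszulD
  rw [Fin.sum_univ_succ, sub_eq_add_neg, ← Finset.sum_neg_distrib]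
  congr 1
  · simp
  · refine Finset.sum_congr rfl fun j _ => ?_
    rw [h]
    simp [pow_succ]

theorem koszulD_smul (r : R) (u : (Fin p → ι) → M) :
    koszulD y (r • u) = r • koszulD y u := by
  funext t
  simp [koszulD, Finset.smul_sum, smul_smul, mul_comm]

theorem koszulD_sub (u v : (Fin p → ι) → M) :
    koszulD y (u - v) = koszulD y u - koszulD y v := by
  funext t
  simp [koszulD, smul_sub]

theorem koszulD_map {N : Type*} [AddCommGroup N] [Module R N] (φ : M →ₗ[R] N)
    (u : (Fin p → ι) → M) (t : Fin (p + 1) → ι) :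
    koszulD y (fun s => φ (u s)) t = φ (koszulD y u t) := by
  simp [koszulD]

theorem koszulD_koszulD (u : (Fin p → ι) → M) : koszulD y (koszulD y u) = 0 := by
  induction p with
  | zero =>
    funext t
    induction t using Fin.consCases with
    | _ i t =>
      rw [koszulD_cons]
      simp only [koszulD_zero_left, Fin.cons_zero, Pi.zero_apply, smul_smul]
      rw [mul_comm, sub_self]
  | succ p ih =>
    funext t
    induction t using Fin.consCases with
    | _ i t =>
      have h : (fun s : Fin (p + 1) → ι => koszulD y u (Fin.cons i s)) =
          y i • u - koszulD y (fun s : Fin p → ι => u (Fin.cons i s)) := by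
        funext s
        rw [koszulD_cons]
        rfl
      rw [koszulD_cons, h, koszulD_sub, koszulD_smul, ih]
      simp

/-- Contraction with `a` is a homotopy between multiplication by `∑ i, a i * y i` and zero; on a
cocycle, `koszulD_cons` leaves a single term for each first index. -/
theorem smul_eq_koszulD_of_koszulD_eq_zero [Fintype ι] (a : ι → R) (u : (Fin (p + 1) → ι) → M)
    (hu : koszulD y u = 0) :
    (∑ i, a i * y i) • u = koszulD y (fun s : Fin p → ι => ∑ i, a i • u (Fin.cons i s)) := by
  funext t
  have h (i : ι) : y i • u t = koszulD y (fun s : Fin p → ι => u (Fin.cons i s)) t := by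
    rw [← sub_eq_zero, ← koszulD_cons, hu]
    rfl
  rw [Pi.smul_apply, Finset.sum_smul]
  simp_rw [mul_smul, h]
  simp only [koszulD, Finset.smul_sum]
  rw [Finset.sum_comm]
  refine Finset.sum_congr rfl fun j _ => Finset.sum_congr rfl fun i _ => ?_
  rw [smul_comm]

end

variable (y : ι → R)

theorem exists_koszulD_eq_of_pow_smul {M : Type*} [AddCommGroup M] [Module R M] {p : ℕ} {r : R}
    (h : ∀ u : (Fin (p + 1) → ι) → M, (∃ w, r • u = koszulD y w) → ∃ w, u = koszulD y w)
    (N : ℕ) (u : (Fin (p + 1) → ι) → M) (hu : ∃ w, r ^ N • u = koszulD y w) :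
    ∃ w, u = koszulD y w := by
  induction N with
  | zero => simpa using hu
  | succ N ih => exact ih (h _ (by simpa [smul_smul, ← pow_succ'] using hu))

variable [Fintype ι]

/-- The vanishing of cohomology in degree zero. -/
theorem eq_zero_of_forall_smul_eq_zero {M : Type*} [AddCommGroup M] [Module R M] {r : R}
    (hr : IsSMulRegular M r) (hy : ∃ N : ℕ, r ^ N ∈ Ideal.span (Set.range y)) {m : M}
    (hm : ∀ i, y i • m = 0) : m = 0 := by
  obtain ⟨N, hN⟩ := hy
  obtain ⟨a, ha⟩ := Ideal.mem_span_range_iff_exists_fun.1 hN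
  refine (hr.pow N) ?_
  simp [← ha, Finset.sum_smul, mul_smul, hm]

open RingTheory.Sequence in
/-- The Koszul cohomology of `M` vanishes in positive degrees below the length of a weakly regular
sequence contained in the radical of the ideal generated by `y`. -/
theorem exists_koszulD_eq {M : Type*} [AddCommGroup M] [Module R M] (rs : List R)
    (hrs : IsWeaklyRegular M rs)
    (hy : ∀ r ∈ rs, ∃ N : ℕ, r ^ N ∈ Ideal.span (Set.range y)) {p : ℕ} (hp : p + 1 < rs.length)
    (u : (Fin (p + 1) → ι) → M) (hu : koszulD y u = 0) : ∃ w, u = koszulD y w := by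
  induction rs generalizing M p with
  | nil => simp at hp
  | cons r rs ih =>
    rw [isWeaklyRegular_cons_iff] at hrs
    obtain ⟨hr, hrs⟩ := hrs
    obtain ⟨N, hN⟩ := hy r (by simp)
    obtain ⟨a, ha⟩ := Ideal.mem_span_range_iff_exists_fun.1 hN
    -- A power of `r` lies in the ideal of `y`, hence kills the class of `u`; it remains to cancel
    -- one factor `r` at a time.
    refine exists_koszulD_eq_of_pow_smul y ?_ N u
      ⟨_, ha ▸ smul_eq_koszulD_of_koszulD_eq_zero y a u hu⟩
    rintro u ⟨w, hw⟩
    set π : M →ₗ[R] QuotSMulTop r M := Submodule.mkQ _ with hπ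
    have hker (m : M) (hm : π m = 0) : ∃ z, m = r • z := by
      rw [hπ, Submodule.mkQ_apply, Submodule.Quotient.mk_eq_zero,
        Submodule.mem_smul_pointwise_iff_exists] at hm
      obtain ⟨z, -, hz⟩ := hm
      exact ⟨z, hz.symm⟩
    have hπr (m : M) : π (r • m) = 0 := by
      rw [hπ, Submodule.mkQ_apply, Submodule.Quotient.mk_eq_zero]
      exact Submodule.smul_mem_pointwise_smul _ _ _ trivial
    have hw' : koszulD y (fun s => π (w s)) = 0 := by
      funext t
      rw [koszulD_map, ← hw]
      exact hπr _
    -- Modulo `r`, the cochain `w` is a cocycle, so by induction it is a coboundary plus a multiple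
    -- of `r`; the coboundary part does not affect `koszulD y w`.
    have key : ∃ v : (Fin p → ι) → M, koszulD y w = r • koszulD y v := by
      have lift (x : (Fin p → ι) → M) (hx : ∀ s, π (x s) = 0) (hd : koszulD y w = koszulD y x) :
          ∃ v : (Fin p → ι) → M, koszulD y w = r • koszulD y v := by
        choose v hv using fun s => hker _ (hx s)
        refine ⟨v, ?_⟩
        rw [hd, ← koszulD_smul]
        exact congrArg _ (funext hv)
      cases p with
      | zero =>
        -- In degree zero a cocycle modulo `r` vanishes outright, because the sequence has a second
        -- element, regular on `M / rM`.
        refine lift w (fun s => ?_) rfl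
        cases rs with
        | nil => simp at hp
        | cons r' rs =>
          rw [isWeaklyRegular_cons_iff] at hrs
          refine eq_zero_of_forall_smul_eq_zero y hrs.1 (hy r' (by simp)) fun i => ?_
          have := congrFun hw' fun _ => i
          rwa [koszulD_zero_left, Subsingleton.elim Fin.elim0 s] at this
      | succ q =>
        obtain ⟨z, hz⟩ := ih hrs (fun a ha => hy a (by simp [ha])) (by simpa using hp) _ hw'
        choose z' hz' using fun s => Submodule.mkQ_surjective _ (z s)
        refine lift (w - koszulD y z') (fun s => ?_) ?_
        · have h1 := congrFun hz s
          have h2 : koszulD y z s = π (koszulD y z' s) := by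
            rw [← koszulD_map]
            exact congrFun (congrArg _ (funext fun s => (hz' s).symm)) s
          rw [Pi.sub_apply, map_sub, h1, h2, sub_self]
        · rw [koszulD_sub, koszulD_koszulD, sub_zero]
    obtain ⟨v, hv⟩ := key
    refine ⟨v, funext fun t => hr ?_⟩
    exact congrFun (hw.trans hv) t

end Koszul

/-! ### Squarefree monomials and supports -/

section SquarefreeMonomials

variable {K : Type*} [Field K] {n : ℕ}

theorem prod_X_eq_monomial (F : Finset (Fin n)) :
    ∏ i ∈ F, (X i : MvPolynomial (Fin n) K) = monomial (∑ i ∈ F, Finsupp.single i 1) 1 :=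
  (monomial_sum_one _ _).symm

theorem sum_single_apply (F : Finset (Fin n)) (j : Fin n) :
    (∑ i ∈ F, Finsupp.single i 1 : Fin n →₀ ℕ) j = if j ∈ F then 1 else 0 := by
  simp [Finsupp.finsetSum_apply, Finsupp.single_apply]

theorem support_sum_single (F : Finset (Fin n)) :
    (∑ i ∈ F, Finsupp.single i 1 : Fin n →₀ ℕ).support = F := by
  ext j
  simp [sum_single_apply]

theorem sum_single_le_iff (F : Finset (Fin n)) (α : Fin n →₀ ℕ) :
    (∑ i ∈ F, Finsupp.single i 1 : Fin n →₀ ℕ) ≤ α ↔ F ⊆ α.support := by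
  rw [Finsupp.le_def]
  refine ⟨fun h j hj => ?_, fun h j => ?_⟩
  · have := h j
    rw [sum_single_apply, if_pos hj] at this
    simp only [Finsupp.mem_support_iff]
    omega
  · rw [sum_single_apply]
    split_ifs with hj
    · have := h hj
      simp only [Finsupp.mem_support_iff] at this
      omega
    · exact Nat.zero_le _

variable {I : Ideal (MvPolynomial (Fin n) K)}

theorem prod_X_mem_mono {F G : Finset (Fin n)} (h : F ⊆ G)
    (hF : ∏ i ∈ F, X i ∈ I) : ∏ i ∈ G, X i ∈ I :=
  Ideal.mem_of_dvd _ (Finset.prod_dvd_prod_of_subset F G X h) hF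

/-- A squarefree monomial ideal is determined by the squarefree monomials it contains. -/
theorem IsSquarefreeMonomialIdeal.mem_iff (hI : IsSquarefreeMonomialIdeal I)
    (f : MvPolynomial (Fin n) K) :
    f ∈ I ↔ ∀ α ∈ f.support, ∏ i ∈ α.support, X i ∈ I := by
  obtain ⟨𝓕, rfl⟩ := hI
  have h : (fun F : Finset (Fin n) => ∏ i ∈ F, (X i : MvPolynomial (Fin n) K)) '' 𝓕 =
      (fun s => monomial s 1) '' ((fun F => ∑ i ∈ F, Finsupp.single i 1) '' 𝓕) := by
    rw [Set.image_image]
    exact Set.image_congr fun F _ => prod_X_eq_monomial F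
  have key (g : MvPolynomial (Fin n) K) :
      g ∈ Ideal.span ((fun F : Finset (Fin n) => ∏ i ∈ F, (X i : MvPolynomial (Fin n) K)) '' 𝓕) ↔
        ∀ α ∈ g.support, ∃ F ∈ 𝓕, F ⊆ α.support := by
    rw [h, mem_ideal_span_monomial_image]
    simp only [Set.exists_mem_image, sum_single_le_iff]
  rw [key f]
  refine forall₂_congr fun α _ => ?_
  classical rw [key, prod_X_eq_monomial, support_monomial, if_neg one_ne_zero]
  simp [support_sum_single]

theorem coeff_X_sq_mul (α : Fin n →₀ ℕ) (i : Fin n) (g : MvPolynomial (Fin n) K) (h : α i < 2) :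
    coeff α (X i ^ 2 * g) = 0 := by
  rw [X_pow_eq_monomial, coeff_monomial_mul', if_neg]
  intro hle
  have := hle i
  simp at this
  omega

end SquarefreeMonomials

/-! ### Upper bounds for the depth -/

section DepthBound

variable {K : Type*} [Field K] {n : ℕ} {I : Ideal (MvPolynomial (Fin n) K)}

/-- The alternating cochain that takes the value `f` on the tuple `e`. -/
noncomputable def detCochain {k : ℕ} (f : MvPolynomial (Fin n) K) (e : Fin k → Fin n) :
    (Fin k → Fin n) → MvPolynomial (Fin n) K :=
  fun t => f * (Matrix.of fun i j => if t i = e j then 1 else 0).det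

theorem detCochain_self {k : ℕ} (f : MvPolynomial (Fin n) K) {e : Fin k → Fin n}
    (he : Function.Injective e) : detCochain f e e = f := by
  have : (Matrix.of fun i j => if e i = e j then (1 : MvPolynomial (Fin n) K) else 0) = 1 := by
    ext i j
    simp [Matrix.one_apply, he.eq_iff]
  rw [detCochain, this, Matrix.det_one, mul_one]

/-- The differential is a Laplace expansion along an extra column with entries `y (t i) * f`.
Subtracting multiples of the other columns clears the entries with `t i` in the range of `e`; the
surviving entries lie in `I`. -/
theorem koszulD_detCochain_mem {k : ℕ} (f : MvPolynomial (Fin n) K) {e : Fin k → Fin n}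
    (he : Function.Injective e) (y : Fin n → MvPolynomial (Fin n) K)
    (hf : ∀ j, j ∉ Set.range e → y j * f ∈ I) (t : Fin (k + 1) → Fin n) :
    koszulD y (detCochain f e) t ∈ I := by
  set δ : Fin n → Fin k → MvPolynomial (Fin n) K := fun i j => if i = e j then 1 else 0 with hδ
  set D : Fin (k + 1) → MvPolynomial (Fin n) K := fun i =>
    (-1) ^ (i : ℕ) * (Matrix.of fun a b => δ (t (i.succAbove a)) b).det with hD
  -- Expansion along the first column of a determinant in which that column is repeated.
  have hzero (b : Fin k) : ∑ i, δ (t i) b * D i = 0 := by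
    have h := Matrix.det_zero_of_column_eq
      (M := Matrix.of fun i : Fin (k + 1) => (Fin.cons (δ (t i) b) (δ (t i)) :
        Fin (k + 1) → MvPolynomial (Fin n) K)) (Fin.succ_ne_zero b).symm (by intro i; simp)
    rw [Matrix.det_succ_column_zero] at h
    rw [← h]
    refine Finset.sum_congr rfl fun i _ => ?_
    have : (Matrix.of fun i : Fin (k + 1) => (Fin.cons (δ (t i) b) (δ (t i)) :
        Fin (k + 1) → MvPolynomial (Fin n) K)).submatrix i.succAbove Fin.succ =
        Matrix.of fun a b => δ (t (i.succAbove a)) b := by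
      ext a b
      simp
    rw [this, hD]
    simp
    ring
  have hsum : koszulD y (detCochain f e) t = ∑ i, (y (t i) * f) * D i := by
    refine Finset.sum_congr rfl fun i _ => ?_
    rw [hD, detCochain, smul_eq_mul]
    ring
  have hsub : koszulD y (detCochain f e) t =
      ∑ i, (y (t i) * f - ∑ b, y (e b) * f * δ (t i) b) * D i := by
    rw [hsum, ← sub_eq_zero, ← Finset.sum_sub_distrib]
    have (i : Fin (k + 1)) : y (t i) * f * D i -
        (y (t i) * f - ∑ b, y (e b) * f * δ (t i) b) * D i =
        ∑ b, y (e b) * f * (δ (t i) b * D i) := by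
      rw [← sub_mul, sub_sub_cancel, Finset.sum_mul]
      exact Finset.sum_congr rfl fun b _ => by ring
    simp_rw [this]
    rw [Finset.sum_comm]
    simp_rw [← Finset.mul_sum, hzero]
    simp
  rw [hsub]
  refine Ideal.sum_mem _ fun i _ => Ideal.mul_mem_right _ _ ?_
  by_cases hi : t i ∈ Set.range e
  · obtain ⟨b, hb⟩ := hi
    rw [Finset.sum_eq_single b]
    · simp [hδ, hb]
    · intro c _ hc
      simp [hδ, ← hb, he.ne hc.symm]
    · simp
  · rw [Finset.sum_eq_zero]
    · simpa using hf _ hi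
    · intro b _
      have : t i ≠ e b := fun h => hi ⟨b, h.symm⟩
      simp [hδ, this]

theorem exists_pow_mem_span_X_sq {r : MvPolynomial (Fin n) K} (hr : r ∈ idealOfVars (Fin n) K) :
    ∃ N : ℕ, r ^ N ∈ Ideal.span (Set.range fun i : Fin n => (X i ^ 2 : MvPolynomial (Fin n) K)) := by
  have h : idealOfVars (Fin n) K ≤ (Ideal.span
      (Set.range fun i : Fin n => (X i ^ 2 : MvPolynomial (Fin n) K))).radical := by
    refine Ideal.span_le.2 ?_
    rintro _ ⟨i, rfl⟩
    exact ⟨2, Ideal.subset_span ⟨i, rfl⟩⟩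
  exact h hr

open RingTheory.Sequence in
/-- A facet `F` of the Stanley–Reisner complex of `I ≠ 0` bounds the depth of `I` by `|F| + 1`. -/
theorem length_le_of_facet (hI : IsSquarefreeMonomialIdeal I) {F : Finset (Fin n)}
    (hF : ∏ i ∈ F, X i ∉ I) (hmax : ∀ j ∉ F, ∏ i ∈ insert j F, X i ∈ I)
    (huniv : F ≠ Finset.univ) {rs : List (MvPolynomial (Fin n) K)}
    (hrs : ∀ r ∈ rs, r ∈ idealOfVars (Fin n) K) (hreg : IsWeaklyRegular I rs) :
    rs.length ≤ F.card + 1 := by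
  by_contra! hlt
  obtain ⟨a, ha⟩ : ∃ a, a ∉ F := by
    by_contra! h
    exact huniv (Finset.eq_univ_of_forall h)
  set e : Fin F.card → Fin n := ⇑(F.orderEmbOfFin rfl) with he_def
  have he : Function.Injective e := (F.orderEmbOfFin rfl).injective
  have hmem (j) : e j ∈ F := F.orderEmbOfFin_mem rfl j
  set f : MvPolynomial (Fin n) K := ∏ i ∈ F, X i with hf_def
  -- Squares are used so that the squarefree monomial `f` stays outside the ideal of the `y i`.
  set y : Fin n → MvPolynomial (Fin n) K := fun i => X i ^ 2 with hy_def
  have hf : ∀ j, j ∉ Set.range e → y j * f ∈ I := by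
    intro j hj
    have hj' : j ∉ F := by rwa [he_def, Finset.range_orderEmbOfFin, Finset.mem_coe] at hj
    have := hmax j hj'
    rw [Finset.prod_insert hj'] at this
    have hyj : y j * f = X j * (X j * f) := by
      simp only [hy_def]
      ring
    exact hyj ▸ I.mul_mem_left _ this
  set c := detCochain f e with hc
  -- The connecting map: `c` is a cocycle only modulo `I`, and its differential has values in `I`.
  let u : (Fin (F.card + 1) → Fin n) → I :=
    fun t => ⟨koszulD y c t, koszulD_detCochain_mem f he y hf t⟩
  have hu : koszulD y u = 0 := by
    funext t
    refine Subtype.ext ?_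
    have := koszulD_map y I.subtype u t
    refine this.symm.trans ?_
    exact congrFun (koszulD_koszulD y c) t
  obtain ⟨w, hw⟩ := exists_koszulD_eq y rs hreg (fun r hr => exists_pow_mem_span_X_sq (hrs r hr))
    hlt u hu
  set g : (Fin F.card → Fin n) → MvPolynomial (Fin n) K :=
    c - fun s => (w s : MvPolynomial (Fin n) K) with hg
  have hdg : koszulD y g = 0 := by
    rw [hg, koszulD_sub, sub_eq_zero]
    funext t
    exact (congrArg Subtype.val (congrFun hw t)).trans (koszulD_map y I.subtype w t).symm
  set α : Fin n →₀ ℕ := ∑ i ∈ F, Finsupp.single i 1 with hα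
  have hge : coeff α (g e) = 1 := by
    have h1 : coeff α (w e : MvPolynomial (Fin n) K) = 0 := by
      by_contra h
      have := (hI.mem_iff _).1 (w e).2 α (mem_support_iff.2 h)
      rw [hα, support_sum_single] at this
      exact hF this
    rw [hg, Pi.sub_apply, coeff_sub, h1, hc, detCochain_self f he, hf_def, prod_X_eq_monomial]
    simp [hα]
  -- In the cocycle equation at `(a, e)`, the term of `a` contributes the coefficient 1 of `f`.
  -- Every other term is divisible by some `X (e j) ^ 2`, but `e j` has exponent 1 in the chosen
  -- monomial.
  have hcoeff := congrArg (coeff (Finsupp.single a 2 + α)) (congrFun hdg (Fin.cons a e))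
  unfold koszulD at hcoeff
  rw [Fin.sum_univ_succ, coeff_add, coeff_sum, Finset.sum_eq_zero, add_zero] at hcoeff
  · simp [hy_def, X_pow_eq_monomial, coeff_monomial_mul, hge] at hcoeff
  · intro j _
    have h1 : (Finsupp.single a 2 + α : Fin n →₀ ℕ) (e j) < 2 := by
      have : a ≠ e j := fun h => ha (h ▸ hmem j)
      rw [Finsupp.add_apply, hα, sum_single_apply, if_pos (hmem j), Finsupp.single_eq_of_ne this.symm]
      norm_num
    rw [smul_eq_mul, Fin.cons_succ, mul_comm _ (y (e j)), mul_assoc]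
    exact coeff_X_sq_mul _ _ _ h1

open RingTheory.Sequence in
/-- The depth of a nonzero squarefree monomial ideal is at most the number of variables. -/
theorem length_le_of_prod_univ_mem {I : Ideal (MvPolynomial (Fin (n + 1)) K)}
    (hI : ∏ i, X i ∈ I) {rs : List (MvPolynomial (Fin (n + 1)) K)}
    (hrs : ∀ r ∈ rs, r ∈ idealOfVars (Fin (n + 1)) K) (hreg : IsWeaklyRegular I rs) :
    rs.length ≤ n + 1 := by
  by_contra! hlt
  set f : MvPolynomial (Fin (n + 1)) K := ∏ i, X i with hf
  set y : Fin (n + 1) → MvPolynomial (Fin (n + 1)) K := fun i => X i ^ 2 with hy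
  let u : (Fin (n + 1) → Fin (n + 1)) → I :=
    fun t => ⟨detCochain f id t, I.mul_mem_right _ hI⟩
  have hu : koszulD y u = 0 := by
    funext t
    refine Subtype.ext ((koszulD_map y I.subtype u t).symm.trans ?_)
    -- Since `id` is surjective, no index lies outside its range, so the differential is zero even
    -- modulo `⊥`.
    exact koszulD_detCochain_mem (I := ⊥) f Function.injective_id y (by simp) t
  obtain ⟨w, hw⟩ := exists_koszulD_eq y rs hreg (fun r hr => exists_pow_mem_span_X_sq (hrs r hr))
    hlt u hu
  have h1 : f = koszulD y (fun s => (w s : MvPolynomial (Fin (n + 1)) K)) id := by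
    rw [← detCochain_self f Function.injective_id]
    exact (congrArg Subtype.val (congrFun hw id)).trans (koszulD_map y I.subtype w id).symm
  set α : Fin (n + 1) →₀ ℕ := ∑ i, Finsupp.single i 1 with hα
  have h2 : coeff α f = 0 := by
    rw [h1, koszulD, coeff_sum]
    refine Finset.sum_eq_zero fun j _ => ?_
    rw [smul_eq_mul, mul_comm _ (y _), mul_assoc]
    refine coeff_X_sq_mul _ _ _ ?_
    rw [hα, sum_single_apply]
    simp
  rw [hf, prod_X_eq_monomial, coeff_monomial, if_pos rfl] at h2
  exact one_ne_zero h2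

end DepthBound

/-! ### From interval partitions to Stanley decompositions -/

section Intervals

variable {K : Type*} [Field K] {n : ℕ} {I : Ideal (MvPolynomial (Fin n) K)}

theorem mem_stanleySpace_prod_X {F Z : Finset (Fin n)} (hF : ∏ i ∈ F, X i ∈ I) {x : I} :
    x ∈ stanleySpace K (⟨∏ i ∈ F, X i, hF⟩ : I) Z ↔
      ∃ g ∈ supported K (Z : Set (Fin n)), g * ∏ i ∈ F, X i = (x : MvPolynomial (Fin n) K) := by
  simp [stanleySpace, Subtype.ext_iff]

theorem support_of_mem_stanleySpace {F Z : Finset (Fin n)} (hFZ : F ⊆ Z)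
    (hF : ∏ i ∈ F, X i ∈ I) {x : I} (hx : x ∈ stanleySpace K (⟨∏ i ∈ F, X i, hF⟩ : I) Z)
    {α : Fin n →₀ ℕ} (hα : coeff α (x : MvPolynomial (Fin n) K) ≠ 0) :
    F ⊆ α.support ∧ α.support ⊆ Z := by
  obtain ⟨g, hg, hgx⟩ := (mem_stanleySpace_prod_X hF).1 hx
  rw [← hgx, prod_X_eq_monomial, coeff_mul_monomial'] at hα
  split_ifs at hα with hle
  · refine ⟨(sum_single_le_iff F α).1 hle, fun j hj => ?_⟩
    by_cases hjF : j ∈ F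
    · exact hFZ hjF
    · refine mem_supported.1 hg ?_
      rw [mul_one] at hα
      refine Finset.mem_coe.2 ((mem_vars_iff_mem_support j).2 ⟨_, mem_support_iff.2 hα, ?_⟩)
      rw [Finsupp.mem_support_iff, Finsupp.tsub_apply, sum_single_apply, if_neg hjF]
      simpa using hj
  · exact absurd rfl hα

theorem monomial_mem_stanleySpace {F Z : Finset (Fin n)} (hF : ∏ i ∈ F, X i ∈ I)
    {α : Fin n →₀ ℕ} (hFα : F ⊆ α.support) (hαZ : α.support ⊆ Z) {c : K} {x : I}
    (hx : (x : MvPolynomial (Fin n) K) = monomial α c) :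
    x ∈ stanleySpace K (⟨∏ i ∈ F, X i, hF⟩ : I) Z := by
  refine (mem_stanleySpace_prod_X hF).2 ⟨monomial (α - ∑ i ∈ F, Finsupp.single i 1) c, ?_, ?_⟩
  · rw [mem_supported]
    intro j hj
    obtain ⟨β, hβ, hjβ⟩ := (mem_vars_iff_mem_support j).1 (Finset.mem_coe.1 hj)
    have hβ' := Finset.mem_singleton.1 (support_monomial_subset hβ)
    subst hβ'
    refine hαZ ?_
    simp only [Finsupp.mem_support_iff, Finsupp.tsub_apply] at hjβ ⊢
    omega
  · rw [hx, prod_X_eq_monomial, monomial_mul, mul_one,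
      tsub_add_cancel_of_le ((sum_single_le_iff F α).2 hFα)]

/-- A partition of the squarefree part of `I` into intervals `[A i, B i]` induces a Stanley
decomposition of `I`. -/
noncomputable def intervalDecomposition (hI : IsSquarefreeMonomialIdeal I) {r : ℕ}
    (A B : Fin r → Finset (Fin n)) (hAB : ∀ i, A i ⊆ B i) (hA : ∀ i, ∏ j ∈ A i, X j ∈ I)
    (hdisj : ∀ i j T, A i ⊆ T → T ⊆ B i → A j ⊆ T → T ⊆ B j → i = j)
    (hcov : ∀ T : Finset (Fin n), ∏ j ∈ T, X j ∈ I → ∃ i, A i ⊆ T ∧ T ⊆ B i) :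
    StanleyDecomposition K (multigrading I) where
  r := r
  m i := ⟨∏ j ∈ A i, X j, hA i⟩
  Z := B
  homogeneous i := by
    refine ⟨Finsupp.weight (fun i : Fin n => (Pi.single i 1 : Fin n → ℤ))
      (∑ j ∈ A i, Finsupp.single j 1), ?_⟩
    change (∏ j ∈ A i, X j : MvPolynomial (Fin n) K) ∈ weightedHomogeneousSubmodule K _ _
    rw [prod_X_eq_monomial]
    exact isWeightedHomogeneous_monomial _ _ _ rfl
  free i f _ h := by
    have h' : f * ∏ j ∈ A i, X j = 0 := congrArg Subtype.val h
    exact (mul_eq_zero.1 h').resolve_right (Finset.prod_ne_zero_iff.2 fun j _ => X_ne_zero j)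
  internal := by
    rw [DirectSum.isInternal_submodule_iff_iSupIndep_and_iSup_eq_top]
    constructor
    · intro i
      -- The elements with no monomial supported in the `i`-th interval; this space contains all the
      -- other Stanley spaces.
      let P : Submodule K I :=
        { carrier := {x | ∀ α : Fin n →₀ ℕ, A i ⊆ α.support → α.support ⊆ B i →
            coeff α (x : MvPolynomial (Fin n) K) = 0}
          add_mem' := fun {a b} ha hb α h1 h2 => by
            simp [ha α h1 h2, hb α h1 h2]
          zero_mem' := fun α _ _ => by simp
          smul_mem' := fun c x hx α h1 h2 => by
            change coeff α (c • (x : MvPolynomial (Fin n) K)) = 0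
            simp [hx α h1 h2] }
      have hP : ⨆ j, ⨆ (_ : j ≠ i), stanleySpace K (⟨∏ l ∈ A j, X l, hA j⟩ : I) (B j) ≤ P := by
        refine iSup₂_le fun j hj x hx α h1 h2 => ?_
        by_contra hα
        obtain ⟨h3, h4⟩ := support_of_mem_stanleySpace (hAB j) (hA j) hx hα
        exact hj (hdisj j i _ h3 h4 h1 h2)
      refine Disjoint.mono_right hP ?_
      rw [Submodule.disjoint_def]
      intro x hx hxP
      refine Subtype.ext (MvPolynomial.ext _ _ fun α => ?_)
      by_contra hα
      obtain ⟨h1, h2⟩ := support_of_mem_stanleySpace (hAB i) (hA i) hx hα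
      exact hα (hxP α h1 h2)
    · rw [eq_top_iff]
      rintro x -
      have hmem (α : Fin n →₀ ℕ) : monomial α (coeff α (x : MvPolynomial (Fin n) K)) ∈ I := by
        rw [hI.mem_iff]
        intro β hβ
        have hβ' := Finset.mem_singleton.1 (support_monomial_subset hβ)
        subst hβ'
        rw [mem_support_iff, coeff_monomial, if_pos rfl] at hβ
        exact (hI.mem_iff _).1 x.2 β (mem_support_iff.2 hβ)
      have hx : x = ∑ α ∈ (x : MvPolynomial (Fin n) K).support, (⟨_, hmem α⟩ : I) := by
        refine Subtype.ext ?_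
        rw [AddSubmonoidClass.coe_finsetSum]
        exact (x : MvPolynomial (Fin n) K).as_sum
      rw [hx]
      refine Submodule.sum_mem _ fun α hα => ?_
      obtain ⟨i, h1, h2⟩ := hcov _ ((hI.mem_iff _).1 x.2 α hα)
      exact Submodule.mem_iSup_of_mem i (monomial_mem_stanleySpace (hA i) h1 h2 rfl)

theorem le_stanleyDepth_of_partition (hI : IsSquarefreeMonomialIdeal I) {κ : Type*} [Finite κ]
    (d : ℕ) (A B : κ → Finset (Fin n)) (hAB : ∀ i, A i ⊆ B i) (hd : ∀ i, d ≤ (B i).card)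
    (hA : ∀ i, ∏ j ∈ A i, X j ∈ I)
    (hdisj : ∀ i j T, A i ⊆ T → T ⊆ B i → A j ⊆ T → T ⊆ B j → i = j)
    (hcov : ∀ T : Finset (Fin n), ∏ j ∈ T, X j ∈ I → ∃ i, A i ⊆ T ∧ T ⊆ B i) :
    (d : ℕ∞) ≤ stanleyDepth K (multigrading I) := by
  obtain ⟨r, ⟨e⟩⟩ := Finite.exists_equiv_fin κ
  refine le_iSup_of_le (intervalDecomposition hI (A ∘ e.symm) (B ∘ e.symm)
    (fun i => hAB _) (fun i => hA _)
    (fun i j T h1 h2 h3 h4 => e.symm.injective (hdisj _ _ T h1 h2 h3 h4))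
    (fun T hT => ?_)) (le_iInf fun i => Nat.cast_le.2 (hd _))
  obtain ⟨i, hi⟩ := hcov T hT
  exact ⟨e i, by simpa using hi⟩

/-- Disjoint intervals which cover the sets of `I` with fewer than `d` elements can be completed to
a partition by one-element intervals. -/
theorem le_stanleyDepth_of_family (hI : IsSquarefreeMonomialIdeal I) (d : ℕ)
    (P : List (Finset (Fin n) × Finset (Fin n)))
    (hle : ∀ p ∈ P, p.1 ⊆ p.2 ∧ d ≤ p.2.card)
    (hdisj : ∀ p ∈ P, ∀ q ∈ P, ∀ T, p.1 ⊆ T → T ⊆ p.2 → q.1 ⊆ T → T ⊆ q.2 → p = q)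
    (hcov : ∀ T : Finset (Fin n), ∏ j ∈ T, X j ∈ I → T.card < d →
      ∃ p ∈ P, ∏ j ∈ p.1, X j ∈ I ∧ p.1 ⊆ T ∧ T ⊆ p.2) :
    (d : ℕ∞) ≤ stanleyDepth K (multigrading I) := by
  let C (T : Finset (Fin n)) : Prop := ∃ p ∈ P, ∏ j ∈ p.1, X j ∈ I ∧ p.1 ⊆ T ∧ T ⊆ p.2
  -- Intervals of `P` with lower end outside `I` are discarded, so one list serves many ideals. A
  -- singleton added for an uncovered set has at least `d` elements by `hcov`.
  let Q (q : Finset (Fin n) × Finset (Fin n)) : Prop :=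
    ∏ j ∈ q.1, X j ∈ I ∧ (q ∈ P ∨ (q.1 = q.2 ∧ ¬ C q.1))
  refine le_stanleyDepth_of_partition hI (κ := {q // Q q}) d (fun q => q.1.1) (fun q => q.1.2)
    ?_ ?_ (fun q => q.2.1) ?_ ?_
  · rintro ⟨q, -, hq | ⟨hq, -⟩⟩
    · exact (hle q hq).1
    · exact hq.subset
  · rintro ⟨q, hqI, hq | ⟨hq, hqC⟩⟩
    · exact (hle q hq).2
    · by_contra! hlt
      change q.2.card < d at hlt
      exact hqC (hcov _ hqI (hq ▸ hlt))
  · rintro ⟨⟨a, b⟩, haI, ha⟩ ⟨⟨a', b'⟩, haI', ha'⟩ T h1 h2 h3 h4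
    refine Subtype.ext ?_
    rcases ha with ha | ⟨hab, haC⟩ <;> rcases ha' with ha' | ⟨hab', haC'⟩
    · exact hdisj _ ha _ ha' T h1 h2 h3 h4
    · change a' = b' at hab'
      subst hab'
      obtain rfl := h3.antisymm h4
      exact absurd ⟨_, ha, haI, h1, h2⟩ haC'
    · change a = b at hab
      subst hab
      obtain rfl := h1.antisymm h2
      exact absurd ⟨_, ha', haI', h3, h4⟩ haC
    · change a = b at hab
      change a' = b' at hab'
      subst hab hab'
      obtain rfl := h1.antisymm h2
      obtain rfl := h3.antisymm h4
      rfl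
  · intro T hT
    by_cases hC : C T
    · obtain ⟨p, hp, hpI, hpT⟩ := hC
      exact ⟨⟨p, hpI, Or.inl hp⟩, hpT⟩
    · exact ⟨⟨(T, T), hT, Or.inr ⟨rfl, hC⟩⟩, subset_rfl, subset_rfl⟩

end Intervals

/-! ### Explicit interval families for four variables -/

section FourVariables

/-- The intervals are pairwise disjoint, and their upper ends have at least `d` elements. -/
def IsIntervalFamily (d : ℕ) (P : List (Finset (Fin 4) × Finset (Fin 4))) : Prop :=
  (∀ p ∈ P, p.1 ⊆ p.2 ∧ d ≤ p.2.card) ∧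
    ∀ p ∈ P, ∀ q ∈ P, p = q ∨ ∀ T, ¬ (p.1 ⊆ T ∧ T ⊆ p.2 ∧ q.1 ⊆ T ∧ T ⊆ q.2)

/-- Each set with fewer than `d` elements that is contained in no set of `L` lies in an interval of
`P` whose lower end is that set itself or a member of `G`. -/
def CoversExcept (d : ℕ) (L G : List (Finset (Fin 4)))
    (P : List (Finset (Fin 4) × Finset (Fin 4))) : Prop :=
  ∀ T : Finset (Fin 4), T.card < d → (∃ F ∈ L, T ⊆ F) ∨
    ∃ p ∈ P, p.1 ⊆ T ∧ T ⊆ p.2 ∧ (p.1 = T ∨ p.1 ∈ G)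

instance (d : ℕ) (P : List (Finset (Fin 4) × Finset (Fin 4))) :
    Decidable (IsIntervalFamily d P) :=
  have (p : Finset (Fin 4) × Finset (Fin 4)) : Decidable (∀ q ∈ P,
      p = q ∨ ∀ T, ¬ (p.1 ⊆ T ∧ T ⊆ p.2 ∧ q.1 ⊆ T ∧ T ⊆ q.2)) := inferInstance
  inferInstanceAs (Decidable (_ ∧ _))

instance (d : ℕ) (L G : List (Finset (Fin 4))) (P : List (Finset (Fin 4) × Finset (Fin 4))) :
    Decidable (CoversExcept d L G P) :=
  inferInstanceAs (Decidable (∀ _, _))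

variable {K : Type*} [Field K] {I : Ideal (MvPolynomial (Fin 4) K)}

theorem le_stanleyDepth_of_isIntervalFamily (hI : IsSquarefreeMonomialIdeal I) {d : ℕ}
    {L G : List (Finset (Fin 4))} {P : List (Finset (Fin 4) × Finset (Fin 4))}
    (hP : IsIntervalFamily d P ∧ CoversExcept d L G P) (hL : ∀ F ∈ L, ∏ i ∈ F, X i ∉ I)
    (hG : ∀ F ∈ G, ∏ i ∈ F, X i ∈ I) : (d : ℕ∞) ≤ stanleyDepth K (multigrading I) := by
  obtain ⟨⟨h1, h2⟩, h3⟩ := hP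
  refine le_stanleyDepth_of_family hI d P h1 (fun p hp q hq T a b c e => ?_) fun T hT hd => ?_
  · exact (h2 p hp q hq).resolve_right fun h => h T ⟨a, b, c, e⟩
  · rcases h3 T hd with ⟨F, hF, hTF⟩ | ⟨p, hp, ha, hb, h | h⟩
    · exact absurd (prod_X_mem_mono hTF hT) (hL F hF)
    · exact ⟨p, hp, by rwa [h], ha, hb⟩
    · exact ⟨p, hp, hG _ h, ha, hb⟩

theorem isIntervalFamily_cycle :
    IsIntervalFamily 2 [({0}, {0, 1}), ({1}, {1, 2}), ({2}, {2, 3}), ({3}, {3, 0})] ∧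
      CoversExcept 2 [∅] [] [({0}, {0, 1}), ({1}, {1, 2}), ({2}, {2, 3}), ({3}, {3, 0})] := by
  decide +kernel

/-- The pairs outside the matching form a 4-cycle, and each is sent to a different triple. -/
theorem isIntervalFamily_matching : ∀ a b c d : Fin 4, [a, b, c, d].Nodup →
    IsIntervalFamily 3
      [({a, c}, {a, c, b}), ({c, b}, {c, b, d}), ({b, d}, {b, d, a}), ({d, a}, {d, a, c})] ∧
    CoversExcept 3 [{a, b}, {c, d}] []
      [({a, c}, {a, c, b}), ({c, b}, {c, b, d}), ({b, d}, {b, d, a}), ({d, a}, {d, a, c})] := by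
  decide +kernel

theorem isIntervalFamily_star : ∀ a b c d : Fin 4, [a, b, c, d].Nodup →
    IsIntervalFamily 3 [({b, c}, {b, c, a}), ({c, d}, {c, d, a}), ({d, b}, {d, b, a})] ∧
    CoversExcept 3 [{a, b}, {a, c}, {a, d}] []
      [({b, c}, {b, c, a}), ({c, d}, {c, d, a}), ({d, b}, {d, b, a})] := by
  decide +kernel

/-- As `{d}` is a non-face, its interval absorbs `{d, a}` and `{d, b}` together with `{d, a, b}`. -/
theorem isIntervalFamily_path : ∀ a b c d : Fin 4, [a, b, c, d].Nodup →
    IsIntervalFamily 3 [({d}, {d, a, b}), ({d, c}, {d, c, a}), ({b, c}, {b, c, a})] ∧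
    CoversExcept 3 [{a, b}, {a, c}] [{d}]
      [({d}, {d, a, b}), ({d, c}, {d, c, a}), ({b, c}, {b, c, a})] := by
  decide +kernel

theorem isIntervalFamily_edge : ∀ a b c d : Fin 4, [a, b, c, d].Nodup →
    IsIntervalFamily 3 [({c}, {c, a, b}), ({d}, {d, c, a}), ({d, b}, {d, b, a})] ∧
    CoversExcept 3 [{a, b}] [{c}, {d}]
      [({c}, {c, a, b}), ({d}, {d, c, a}), ({d, b}, {d, b, a})] := by
  decide +kernel

theorem two_le_stanleyDepth (hI : IsSquarefreeMonomialIdeal I)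
    (h : ∏ i ∈ (∅ : Finset (Fin 4)), X i ∉ I) :
    (2 : ℕ∞) ≤ stanleyDepth K (multigrading I) :=
  mod_cast le_stanleyDepth_of_isIntervalFamily hI isIntervalFamily_cycle (by simpa using h)
    (by simp)

theorem exists_pair_compl : ∀ a b : Fin 4, b ≠ a →
    ∃ c d : Fin 4, [a, b, c, d].Nodup ∧ ∀ x, x = a ∨ x = b ∨ x = c ∨ x = d := by
  decide

/-- A graph without isolated vertices on at most four vertices, with at least one edge, has all its
vertices covered by two disjoint edges, a three-edge star, a two-edge path or one edge. Further
faces do no harm, since their intervals are dropped. -/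
theorem three_le_stanleyDepth (hI : IsSquarefreeMonomialIdeal I)
    (h0 : ∃ a, ∏ i ∈ ({a} : Finset (Fin 4)), X i ∉ I)
    (h1 : ∀ a, ∏ i ∈ ({a} : Finset (Fin 4)), X i ∉ I →
      ∃ b ≠ a, ∏ i ∈ ({a, b} : Finset (Fin 4)), X i ∉ I) :
    (3 : ℕ∞) ≤ stanleyDepth K (multigrading I) := by
  have matching (a b c d : Fin 4) (h : [a, b, c, d].Nodup)
      (hab : ∏ i ∈ ({a, b} : Finset (Fin 4)), X i ∉ I)
      (hcd : ∏ i ∈ ({c, d} : Finset (Fin 4)), X i ∉ I) :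
      (3 : ℕ∞) ≤ stanleyDepth K (multigrading I) :=
    mod_cast le_stanleyDepth_of_isIntervalFamily hI (isIntervalFamily_matching a b c d h)
      (by simp only [List.forall_mem_cons]; exact ⟨hab, hcd, by simp⟩) (by simp)
  have star (a b c d : Fin 4) (h : [a, b, c, d].Nodup)
      (hab : ∏ i ∈ ({a, b} : Finset (Fin 4)), X i ∉ I)
      (hac : ∏ i ∈ ({a, c} : Finset (Fin 4)), X i ∉ I)
      (had : ∏ i ∈ ({a, d} : Finset (Fin 4)), X i ∉ I) :
      (3 : ℕ∞) ≤ stanleyDepth K (multigrading I) :=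
    mod_cast le_stanleyDepth_of_isIntervalFamily hI (isIntervalFamily_star a b c d h)
      (by simp only [List.forall_mem_cons]; exact ⟨hab, hac, had, by simp⟩) (by simp)
  have path (a b c d : Fin 4) (h : [a, b, c, d].Nodup)
      (hab : ∏ i ∈ ({a, b} : Finset (Fin 4)), X i ∉ I)
      (hac : ∏ i ∈ ({a, c} : Finset (Fin 4)), X i ∉ I)
      (hd : ∏ i ∈ ({d} : Finset (Fin 4)), X i ∈ I) :
      (3 : ℕ∞) ≤ stanleyDepth K (multigrading I) :=
    mod_cast le_stanleyDepth_of_isIntervalFamily hI (isIntervalFamily_path a b c d h)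
      (by simp only [List.forall_mem_cons]; exact ⟨hab, hac, by simp⟩)
      (by simp only [List.forall_mem_cons]; exact ⟨hd, by simp⟩)
  have edge (a b c d : Fin 4) (h : [a, b, c, d].Nodup)
      (hab : ∏ i ∈ ({a, b} : Finset (Fin 4)), X i ∉ I)
      (hc : ∏ i ∈ ({c} : Finset (Fin 4)), X i ∈ I)
      (hd : ∏ i ∈ ({d} : Finset (Fin 4)), X i ∈ I) :
      (3 : ℕ∞) ≤ stanleyDepth K (multigrading I) :=
    mod_cast le_stanleyDepth_of_isIntervalFamily hI (isIntervalFamily_edge a b c d h)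
      (by simp only [List.forall_mem_cons]; exact ⟨hab, by simp⟩)
      (by simp only [List.forall_mem_cons]; exact ⟨hc, hd, by simp⟩)
  have comm {a b : Fin 4} (h : ∏ i ∈ ({a, b} : Finset (Fin 4)), X i ∉ I) :
      ∏ i ∈ ({b, a} : Finset (Fin 4)), X i ∉ I := by rwa [Finset.pair_comm]
  have down {a b : Fin 4} (h : ∏ i ∈ ({a} : Finset (Fin 4)), X i ∈ I) :
      ¬ ∏ i ∈ ({b, a} : Finset (Fin 4)), X i ∉ I :=
    not_not_intro (prod_X_mem_mono (by simp) h)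
  obtain ⟨a, ha⟩ := h0
  obtain ⟨b, hba, hab⟩ := h1 a ha
  obtain ⟨c, d, hnd, hall⟩ := exists_pair_compl a b hba
  have neighbours (x : Fin 4) : ∏ i ∈ ({x} : Finset (Fin 4)), X i ∈ I ∨
      ∃ y ≠ x, ∏ i ∈ ({x, y} : Finset (Fin 4)), X i ∉ I := or_iff_not_imp_left.2 (h1 x)
  rcases neighbours c with hc | ⟨x, hxc, hx⟩ <;> rcases neighbours d with hd | ⟨y, hyd, hy⟩
  · exact edge a b c d hnd hab hc hd
  · rcases hall y with rfl | rfl | rfl | rfl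
    · exact path y b d c (by clear * - hnd; grind) hab (comm hy) hc
    · exact path y a d c (by clear * - hnd; grind) (comm hab) (comm hy) hc
    · exact absurd hy (down hc)
    · exact absurd rfl hyd
  · rcases hall x with rfl | rfl | rfl | rfl
    · exact path x b c d (by clear * - hnd; grind) hab (comm hx) hd
    · exact path x a c d (by clear * - hnd; grind) (comm hab) (comm hx) hd
    · exact absurd rfl hxc
    · exact absurd hx (down hd)
  · rcases hall x with rfl | rfl | rfl | rfl
    · rcases hall y with rfl | rfl | rfl | rfl
      · exact star y b c d hnd hab (comm hx) (comm hy)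
      · exact matching x c y d (by clear * - hnd; grind) (comm hx) (comm hy)
      · exact matching x b y d (by clear * - hnd; grind) hab (comm hy)
      · exact absurd rfl hyd
    · rcases hall y with rfl | rfl | rfl | rfl
      · exact matching x c y d (by clear * - hnd; grind) (comm hx) (comm hy)
      · exact star y a c d (by clear * - hnd; grind) (comm hab) (comm hx) (comm hy)
      · exact matching a x y d (by clear * - hnd; grind) hab (comm hy)
      · exact absurd rfl hyd
    · exact absurd rfl hxc
    · exact matching a b c x (by clear * - hnd; grind) hab hx

/-- Every maximal face is the complement of a vertex. With `F` the set of these vertices, the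
non-faces are exactly the supersets of `F`, so the single interval `[F, univ]` suffices. -/
theorem four_le_stanleyDepth (hI : IsSquarefreeMonomialIdeal I) (huniv : ∏ i, X i ∈ I)
    (h : ∀ F : Finset (Fin 4), ∏ i ∈ F, X i ∉ I → F.card ≤ 2 →
      ∃ j ∉ F, ∏ i ∈ insert j F, X i ∉ I) :
    (4 : ℕ∞) ≤ stanleyDepth K (multigrading I) := by
  classical
  let F : Finset (Fin 4) := Finset.univ.filter fun i => ∏ j ∈ {i}ᶜ, X j ∉ I
  have hmem (i : Fin 4) : i ∈ F ↔ ∏ j ∈ {i}ᶜ, X j ∉ I := by simp [F]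
  have hF : ∏ i ∈ F, X i ∈ I := by
    by_contra hF
    obtain ⟨G, hFG, hG⟩ := (Set.toFinite {G : Finset (Fin 4) | ∏ i ∈ G, X i ∉ I}).exists_le_maximal
      hF
    have hcard : 2 < G.card := by
      by_contra! hcard
      obtain ⟨j, hj, hj'⟩ := h G hG.prop hcard
      exact hj (hG.le_of_ge hj' (Finset.subset_insert j G) (Finset.mem_insert_self j G))
    have hGu : G ≠ Finset.univ := fun h => hG.prop (h ▸ huniv)
    have hlt : G.card < 4 := (Finset.card_lt_iff_ne_univ G).2 hGu
    have hcompl : Gᶜ.card = 1 := by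
      rw [Finset.card_compl, Fintype.card_fin]
      omega
    obtain ⟨i, hi⟩ := Finset.card_eq_one.1 hcompl
    have hGi : G = {i}ᶜ := by rw [← hi, compl_compl]
    have : i ∈ G := hFG ((hmem i).2 (hGi ▸ hG.prop))
    simp [hGi] at this
  refine mod_cast le_stanleyDepth_of_family hI 4 [(F, Finset.univ)] (by simp) ?_ ?_
  · simp only [List.mem_singleton]
    rintro p rfl q rfl T - - - -
    rfl
  · intro T hT _
    refine ⟨_, List.mem_singleton_self _, hF, fun i hi => ?_, Finset.subset_univ T⟩
    by_contra hiT
    exact (hmem i).1 hi (prod_X_mem_mono (by simpa using hiT) hT)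

end FourVariables

end StanleyConj

open StanleyConj in
theorem mainTheorem6 {K : Type*} [Field K] (I : Ideal (MvPolynomial (Fin 4) K))
    (hI : StanleyConj.IsSquarefreeMonomialIdeal I) :
    StanleyConj.depth (MvPolynomial.idealOfVars (Fin 4) K) I ≤
      StanleyConj.stanleyDepth K (StanleyConj.multigrading I) := by
  refine iSup₂_le fun rs ⟨hrs, hreg⟩ => ?_
  by_cases huniv : ∏ i, X i ∈ I
  swap
  -- Here `I = 0`: the empty decomposition has Stanley depth `⊤`, which bounds sequences of any
  -- length.
  · have hnot (T : Finset (Fin 4)) : ∏ i ∈ T, X i ∉ I :=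
      fun h => huniv (prod_X_mem_mono (Finset.subset_univ T) h)
    exact le_stanleyDepth_of_partition hI (κ := Empty) rs.length Empty.elim Empty.elim nofun nofun
      nofun nofun fun T hT => absurd hT (hnot T)
  have facet (d : ℕ) (F : Finset (Fin 4)) (hF : ∏ i ∈ F, X i ∉ I) (hd : F.card + 1 ≤ d)
      (hmax : ∀ j ∉ F, ∏ i ∈ insert j F, X i ∈ I) : (rs.length : ℕ∞) ≤ d :=
    Nat.cast_le.2 ((length_le_of_facet hI hF hmax (fun h => hF (h ▸ huniv)) hrs hreg).trans hd)
  by_cases h4 : ∀ F : Finset (Fin 4), ∏ i ∈ F, X i ∉ I → F.card ≤ 2 →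
      ∃ j ∉ F, ∏ i ∈ insert j F, X i ∉ I
  · refine le_trans ?_ (four_le_stanleyDepth hI huniv h4)
    exact mod_cast length_le_of_prod_univ_mem huniv hrs hreg
  push Not at h4
  obtain ⟨F, hF, hFcard, hFmax⟩ := h4
  have hempty : ∏ i ∈ (∅ : Finset (Fin 4)), X i ∉ I :=
    fun h => hF (prod_X_mem_mono (Finset.empty_subset F) h)
  by_cases h3 : ∀ F : Finset (Fin 4), ∏ i ∈ F, X i ∉ I → F.card ≤ 1 →
      ∃ j ∉ F, ∏ i ∈ insert j F, X i ∉ I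
  · refine le_trans (facet 3 F hF (by omega) hFmax) (three_le_stanleyDepth hI ?_ fun a ha => ?_)
    · obtain ⟨a, -, ha⟩ := h3 ∅ hempty (by simp)
      exact ⟨a, by simpa using ha⟩
    · obtain ⟨b, hb, hab⟩ := h3 {a} ha (by simp)
      exact ⟨b, by simpa using hb, by rwa [Finset.pair_comm]⟩
  · push Not at h3
    obtain ⟨G, hG, hGcard, hGmax⟩ := h3
    exact le_trans (facet 2 G hG (by omega) hGmax) (two_le_stanleyDepth hI hempty)
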